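/- Let $n\ge 0$. For an arrangement $\mathcal{A}$ (a finite set of affine hyperplanes) in $\mathbb{R}^n$, let $L(\mathcal{A})$ be the set of all nonempty intersections of hyperplanes of $\mathcal{A}$ (including $\mathbb{R}^n$, the empty intersection), ordered by reverse inclusion, and let $$\chi_{\mathcal{A}}(t)=\sum_{x\in L(\mathcal{A})}\mu(\mathbb{R}^n,x)\,t^{\dim x}\in\mathbb{Z}[t]$$ be its characteristic polynomial, where $\mu$ is the Möbius function of the poset $L(\mathcal{A})$. The regions of $\mathcal{A}$ are the connected components of $\mathbb{R}^n\setminus\bigcup_{H\in\mathcal{A}}H$. Let $\mathcal{A}$ be a sub-arrangement of the type $C$ arrangement in $\mathbb{R}^n$, that is, $\mathcal{A}\subseteq\{x_i\pm x_j=0\mid 1\le i<j\le n\}\cup\{x_i=0\mid 1\le i\le n\}$, and let $\mathcal{BA}=\mathcal{A}\cup\{x_i=-\tfrac12,\ x_i=\tfrac12\mid 1\le i\le n\}$. Then $$\chi_{\mathcal{BA}}(t)=\chi_{\mathcal{A}}(t-2).$$ In particular, for the threshold arrangement $\mathcal{T}_n=\{x_i+x_j=0\mid 1\le i<j\le n\}$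 and the boxed threshold arrangement $\mathcal{BT}_n=\mathcal{T}_n\cup\{x_i=-\tfrac12,\ x_i=\tfrac12\mid 1\le i\le n\}$ one has $$\chi_{\mathcal{BT}_n}(t)=\chi_{\mathcal{T}_n}(t-2),$$ and the number of bounded regions of $\mathcal{BT}_n$ is finite and equal to the (finite) number of regions of $\mathcal{T}_n$. -/

import Mathlib

/-- `H` is an affine hyperplane of `ℝⁿ`: a translate of a linear subspace of codimension one. -/
def IsHyperplane {n : ℕ} (H : AffineSubspace ℝ (Fin n → ℝ)) : Prop :=
  (H : Set (Fin n → ℝ)).Nonempty ∧ Module.finrank ℝ H.direction + 1 = n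

/-- A hyperplane arrangement in `ℝⁿ`: a finite set of affine hyperplanes. -/
structure Arrangement (n : ℕ) where
  hyperplanes : Set (AffineSubspace ℝ (Fin n → ℝ))
  finite : hyperplanes.Finite
  isHyperplane : ∀ H ∈ hyperplanes, IsHyperplane H

namespace Arrangement

/-! ### Intersection poset and characteristic polynomial -/

/-- A flat of `A`: a nonempty intersection of some (possibly none) of the hyperplanes of `A`.
The empty intersection is the whole space. -/
def IsFlat {n : ℕ} (A : Arrangement n) (F : AffineSubspace ℝ (Fin n → ℝ)) : Prop :=
  (F : Set (Fin n → ℝ)).Nonempty ∧ ∃ S ⊆ A.hyperplanes, F = sInf S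

/-- The set of flats of `A`, ordered by reverse inclusion (see the instance below). -/
structure IntersectionPoset {n : ℕ} (A : Arrangement n) where
  flat : AffineSubspace ℝ (Fin n → ℝ)
  isFlat : A.IsFlat flat

namespace IntersectionPoset

theorem flat_injective {n : ℕ} {A : Arrangement n} :
    Function.Injective (fun x : A.IntersectionPoset => x.flat) := by
  rintro ⟨x, hx⟩ ⟨y, hy⟩ h
  cases h
  rfl

/-- Reverse inclusion of flats. -/
instance instPartialOrder {n : ℕ} (A : Arrangement n) : PartialOrder A.IntersectionPoset where
  le x y := y.flat ≤ x.flat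
  le_refl x := le_refl x.flat
  le_trans _ _ _ hxy hyz := le_trans hyz hxy
  le_antisymm _ _ hxy hyx := flat_injective (le_antisymm hyx hxy)

/-- The least element is the whole space. -/
instance instOrderBot {n : ℕ} (A : Arrangement n) : OrderBot A.IntersectionPoset where
  bot := ⟨⊤, ⟨0, trivial⟩, ∅, Set.empty_subset _, sInf_empty.symm⟩
  bot_le x := (le_top : x.flat ≤ ⊤)

instance instFinite {n : ℕ} (A : Arrangement n) : Finite A.IntersectionPoset := by
  have hfin : (sInf '' (Set.powerset A.hyperplanes)).Finite := A.finite.finite_subsets.image _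
  have : Finite (sInf '' (Set.powerset A.hyperplanes)) := hfin
  refine Finite.of_injective
    (fun x : A.IntersectionPoset =>
      (⟨x.flat, ?_⟩ : (sInf '' (Set.powerset A.hyperplanes) : Set _))) ?_
  · obtain ⟨_, S, hS, h⟩ := x.isFlat
    exact ⟨S, hS, h.symm⟩
  · intro x y h
    exact flat_injective (congrArg Subtype.val h)

noncomputable instance instFintype {n : ℕ} (A : Arrangement n) : Fintype A.IntersectionPoset :=
  Fintype.ofFinite _

open Classical in
noncomputable instance instLocallyFiniteOrder {n : ℕ} (A : Arrangement n) : LocallyFiniteOrder A.IntersectionPoset :=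
  Fintype.toLocallyFiniteOrder

/-- The dimension of a flat. -/
noncomputable def dim {n : ℕ} {A : Arrangement n} (x : A.IntersectionPoset) : ℕ :=
  Module.finrank ℝ x.flat.direction

end IntersectionPoset

open Classical in
/-- The characteristic polynomial `∑ₓ μ(0̂, x) t ^ dim x`, the sum being over all flats `x`;
`μ` is the Möbius function of the intersection poset and `0̂ = ℝⁿ`. -/
noncomputable def charPoly {n : ℕ} (A : Arrangement n) : Polynomial ℤ :=
  ∑ x : A.IntersectionPoset,
    Polynomial.C (IncidenceAlgebra.mu ℤ (⊥ : A.IntersectionPoset) x) * Polynomial.X ^ x.dim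

/-! ### Regions -/

/-- The complement in `ℝⁿ` of the union of the hyperplanes. -/
def complement {n : ℕ} (A : Arrangement n) : Set (Fin n → ℝ) :=
  {x | ∀ H ∈ A.hyperplanes, x ∉ H}

/-- The regions: the connected components of the complement. -/
def regions {n : ℕ} (A : Arrangement n) : Set (Set (Fin n → ℝ)) :=
  {R | ∃ x ∈ A.complement, R = connectedComponentIn A.complement x}

/-- The regions that are bounded subsets of `ℝⁿ`. -/
def boundedRegions {n : ℕ} (A : Arrangement n) : Set (Set (Fin n → ℝ)) :=
  {R | R ∈ A.regions ∧ Bornology.IsBounded R}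

end Arrangement

/-! ### The arrangements -/

/-- The affine subspace `{x | f x = c}` of `ℝⁿ`. -/
def levelSet {n : ℕ} (f : (Fin n → ℝ) →ₗ[ℝ] ℝ) (c : ℝ) : AffineSubspace ℝ (Fin n → ℝ) where
  carrier := {x | f x = c}
  smul_vsub_vadd_mem' := by
    intro r p q s hp hq hs
    change f p = c at hp
    change f q = c at hq
    change f s = c at hs
    change f (r • (p - q) + s) = c
    simp [hp, hq, hs]

theorem mem_levelSet {n : ℕ} {f : (Fin n → ℝ) →ₗ[ℝ] ℝ} {c : ℝ} {x : Fin n → ℝ} :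
    x ∈ levelSet f c ↔ f x = c := Iff.rfl

theorem isHyperplane_levelSet {n : ℕ} {f : (Fin n → ℝ) →ₗ[ℝ] ℝ} (hf : f ≠ 0) (c : ℝ) :
    IsHyperplane (levelSet f c) := by
  obtain ⟨p, hp⟩ := LinearMap.surjective hf c
  have hpm : p ∈ levelSet f c := hp
  refine ⟨⟨p, hpm⟩, ?_⟩
  have hd : (levelSet f c).direction = LinearMap.ker f := by
    ext v
    rw [← AffineSubspace.vadd_mem_iff_mem_direction v hpm, mem_levelSet, LinearMap.mem_ker]
    simp [hp]
  rw [hd]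
  have h := LinearMap.finrank_range_add_finrank_ker f
  rw [LinearMap.range_eq_top.mpr (LinearMap.surjective hf), finrank_top] at h
  simp at h
  omega

/-- The coordinate functional `x ↦ x_i` on `ℝⁿ`. -/
abbrev coord {n : ℕ} (i : Fin n) : (Fin n → ℝ) →ₗ[ℝ] ℝ :=
  LinearMap.proj i

/-- The hyperplane `x_i + x_j = 0`. -/
def sumHyperplane {n : ℕ} (i j : Fin n) : AffineSubspace ℝ (Fin n → ℝ) :=
  levelSet (coord i + coord j) 0

/-- The hyperplane `x_i - x_j = 0`. -/
def diffHyperplane {n : ℕ} (i j : Fin n) : AffineSubspace ℝ (Fin n → ℝ) :=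
  levelSet (coord i - coord j) 0

/-- The hyperplane `x_i = c`. -/
def coordHyperplane {n : ℕ} (i : Fin n) (c : ℝ) : AffineSubspace ℝ (Fin n → ℝ) :=
  levelSet (coord i) c

theorem isHyperplane_sumHyperplane {n : ℕ} {i j : Fin n} (h : i < j) :
    IsHyperplane (sumHyperplane i j) := by
  refine isHyperplane_levelSet (fun h0 => ?_) 0
  have := LinearMap.congr_fun h0 (Pi.single i 1)
  simp [Pi.single_eq_of_ne h.ne'] at this

theorem isHyperplane_diffHyperplane {n : ℕ} {i j : Fin n} (h : i < j) :
    IsHyperplane (diffHyperplane i j) := by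
  refine isHyperplane_levelSet (fun h0 => ?_) 0
  have := LinearMap.congr_fun h0 (Pi.single i 1)
  simp [Pi.single_eq_of_ne h.ne'] at this

theorem isHyperplane_coordHyperplane {n : ℕ} (i : Fin n) (c : ℝ) :
    IsHyperplane (coordHyperplane i c) := by
  refine isHyperplane_levelSet (fun h0 => ?_) c
  have := LinearMap.congr_fun h0 (Pi.single i 1)
  simp at this

theorem finite_pairs {n : ℕ} (g : Fin n → Fin n → AffineSubspace ℝ (Fin n → ℝ)) :
    {H | ∃ i j, i < j ∧ H = g i j}.Finite := by
  refine (Set.finite_range (fun p : Fin n × Fin n => g p.1 p.2)).subset ?_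
  rintro H ⟨i, j, _, rfl⟩
  exact ⟨(i, j), rfl⟩

theorem finite_singles {n : ℕ} (g : Fin n → AffineSubspace ℝ (Fin n → ℝ)) :
    {H | ∃ i, H = g i}.Finite := by
  refine (Set.finite_range g).subset ?_
  rintro H ⟨i, rfl⟩
  exact ⟨i, rfl⟩

/-- The type `C` arrangement: `x_i + x_j = 0` and `x_i - x_j = 0` for `i < j`, and `x_i = 0`. -/
def typeC (n : ℕ) : Arrangement n where
  hyperplanes := {H | ∃ i j, i < j ∧ H = sumHyperplane i j} ∪
    {H | ∃ i j, i < j ∧ H = diffHyperplane i j} ∪ {H | ∃ i, H = coordHyperplane i 0}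
  finite := ((finite_pairs _).union (finite_pairs _)).union (finite_singles _)
  isHyperplane := by
    rintro H ((⟨i, j, h, rfl⟩ | ⟨i, j, h, rfl⟩) | ⟨i, rfl⟩)
    · exact isHyperplane_sumHyperplane h
    · exact isHyperplane_diffHyperplane h
    · exact isHyperplane_coordHyperplane i 0

/-- The boxed version of `A`: add the hyperplanes `x_i = -1/2` and `x_i = 1/2` for all `i`. -/
def Arrangement.boxed {n : ℕ} (A : Arrangement n) : Arrangement n where
  hyperplanes := A.hyperplanes ∪
    ({H | ∃ i, H = coordHyperplane i (-(1 / 2))} ∪ {H | ∃ i, H = coordHyperplane i (1 / 2)})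
  finite := A.finite.union ((finite_singles _).union (finite_singles _))
  isHyperplane := by
    rintro H (h | ⟨i, rfl⟩ | ⟨i, rfl⟩)
    · exact A.isHyperplane H h
    · exact isHyperplane_coordHyperplane i _
    · exact isHyperplane_coordHyperplane i _

/-- The threshold arrangement: `x_i + x_j = 0` for `i < j`. -/
def threshold (n : ℕ) : Arrangement n where
  hyperplanes := {H | ∃ i j, i < j ∧ H = sumHyperplane i j}
  finite := finite_pairs _
  isHyperplane := by
    rintro H ⟨i, j, h, rfl⟩
    exact isHyperplane_sumHyperplane h

/-- The boxed threshold arrangement, in centred coordinates: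
`x_i + x_j = 0` for `i < j`, and `x_i = -1/2` and `x_i = 1/2` for all `i`. -/
def boxedThreshold (n : ℕ) : Arrangement n where
  hyperplanes := {H | ∃ i j, i < j ∧ H = sumHyperplane i j} ∪
    ({H | ∃ i, H = coordHyperplane i (-(1 / 2))} ∪ {H | ∃ i, H = coordHyperplane i (1 / 2)})
  finite := (finite_pairs _).union ((finite_singles _).union (finite_singles _))
  isHyperplane := by
    rintro H (⟨i, j, h, rfl⟩ | ⟨i, rfl⟩ | ⟨i, rfl⟩)
    · exact isHyperplane_sumHyperplane h
    · exact isHyperplane_coordHyperplane i _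
    · exact isHyperplane_coordHyperplane i _

/-!
The characteristic polynomial identity is proved by counting grid points, a real version of the
finite field method. Let `X ⊆ ℝ` be a finite set with `X = -X`, containing `0` and, where the boxed
arrangement is concerned, `±1/2`. A flat of an arrangement with hyperplanes `x_i ± x_j = 0` and
`x_i = c`, `c ∈ {0, ±1/2}`, is parametrised by a set `I` of free coordinates, every other coordinate
being `±` a free one or a constant (`SignedParam`, `signedParam_sInf`); hence it contains exactly
`|X| ^ dim` points of `Xⁿ` (`SignedParam.card_grid`). Since the sum of `μ(ℝⁿ, F)` over the flats `F`
through a point `x` is `1` if `x` lies on no hyperplane and `0` otherwise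
(`Arrangement.sum_mu_flats_through`), the characteristic polynomial at `|X|` is the number of points
of `Xⁿ` off the arrangement (`Arrangement.eval_charPoly`). The points of `Xⁿ` off the boxed
arrangement are the points of `(X \ {±1/2})ⁿ` off the original one, so the two polynomials agree at
infinitely many integers.

For the regions, the component of a point in the complement of finitely many level sets of linear
forms is its sign cell (`mem_connectedComponentIn_iff`). In a cell of the boxed threshold arrangement
containing a point `x` outside the box `[-1/2, 1/2]ⁿ`, the coordinates of `x` with `|x_i| > 1/2` can
be multiplied by any factor `≥ 1` without changing a sign of `x_i + x_j`, so the cell is unbounded.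
Therefore the bounded regions are the sets `R ∩ (-1/2, 1/2)ⁿ` for the regions `R` of the threshold
arrangement, and `R ↦ R ∩ (-1/2, 1/2)ⁿ` is injective because every `R` is a cone.
-/

/-! ### Möbius inversion over the flats -/

theorem IsHyperplane.ne_top {n : ℕ} {H : AffineSubspace ℝ (Fin n → ℝ)} (h : IsHyperplane H) :
    H ≠ ⊤ := by
  rintro rfl
  have := h.2
  rw [AffineSubspace.direction_top, finrank_top] at this
  simp at this

namespace Arrangement

variable {n : ℕ}

/-- The smallest flat of `A` containing the point `x`. -/
def flatAt (A : Arrangement n) (x : Fin n → ℝ) : A.IntersectionPoset where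
  flat := sInf {H ∈ A.hyperplanes | x ∈ H}
  isFlat := by
    refine ⟨⟨x, ?_⟩, _, fun H hH => hH.1, rfl⟩
    rw [SetLike.mem_coe, AffineSubspace.mem_sInf_iff]
    exact fun H hH => hH.2

theorem mem_flat_iff_le_flatAt (A : Arrangement n) (x : Fin n → ℝ) (F : A.IntersectionPoset) :
    x ∈ F.flat ↔ F ≤ A.flatAt x := by
  constructor
  · intro hx
    obtain ⟨-, S, hS, hF⟩ := F.isFlat
    change sInf {H ∈ A.hyperplanes | x ∈ H} ≤ F.flat
    rw [hF] at hx ⊢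
    rw [AffineSubspace.mem_sInf_iff] at hx
    exact sInf_le_sInf fun H hH => ⟨hS hH, hx H hH⟩
  · intro h
    have hx : x ∈ (A.flatAt x).flat := by
      change x ∈ sInf {H ∈ A.hyperplanes | x ∈ H}
      rw [AffineSubspace.mem_sInf_iff]
      exact fun H hH => hH.2
    have h' : (A.flatAt x).flat ≤ F.flat := h
    exact h' hx

theorem bot_eq_flatAt_iff (A : Arrangement n) (x : Fin n → ℝ) :
    (⊥ : A.IntersectionPoset) = A.flatAt x ↔ x ∈ A.complement := by
  constructor
  · intro h H hH hx
    have h1 : (⊤ : AffineSubspace ℝ (Fin n → ℝ)) = sInf {H ∈ A.hyperplanes | x ∈ H} :=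
      congrArg IntersectionPoset.flat h
    have h2 : sInf {H ∈ A.hyperplanes | x ∈ H} ≤ H := sInf_le ⟨hH, hx⟩
    exact (A.isHyperplane H hH).ne_top (top_le_iff.mp (h1 ▸ h2))
  · intro h
    apply IntersectionPoset.flat_injective
    change (⊤ : AffineSubspace ℝ (Fin n → ℝ)) = sInf {H ∈ A.hyperplanes | x ∈ H}
    rw [Set.eq_empty_of_forall_notMem (s := {H ∈ A.hyperplanes | x ∈ H}) fun H hH => h H hH.1 hH.2,
      sInf_empty]

open Classical in
/-- The flats through `x` form the interval from `ℝⁿ` to the smallest flat through `x`, so this is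
the defining recursion of the Möbius function. -/
theorem sum_mu_flats_through (A : Arrangement n) (x : Fin n → ℝ) :
    (∑ F : A.IntersectionPoset,
      if x ∈ F.flat then IncidenceAlgebra.mu ℤ (⊥ : A.IntersectionPoset) F else 0) =
      if x ∈ A.complement then 1 else 0 := by
  rw [← Finset.sum_filter]
  have h : Finset.univ.filter (fun F : A.IntersectionPoset => x ∈ F.flat) =
      Finset.Icc ⊥ (A.flatAt x) := by
    ext F
    simp [mem_flat_iff_le_flatAt]
  rw [h, IncidenceAlgebra.sum_Icc_mu_right]
  simp only [bot_eq_flatAt_iff]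

open Classical in
/-- If every flat contains `q ^ dim` points of a finite set `P`, the characteristic polynomial at `q`
counts the points of `P` in the complement. -/
theorem eval_charPoly (A : Arrangement n) (P : Finset (Fin n → ℝ)) (q : ℕ)
    (h : ∀ F : A.IntersectionPoset, (P.filter (· ∈ F.flat)).card = q ^ F.dim) :
    A.charPoly.eval (q : ℤ) = (P.filter (· ∈ A.complement)).card := by
  have h1 : A.charPoly.eval (q : ℤ) = ∑ F : A.IntersectionPoset, ∑ x ∈ P,
      if x ∈ F.flat then IncidenceAlgebra.mu ℤ (⊥ : A.IntersectionPoset) F else 0 := by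
    rw [charPoly, Polynomial.eval_finsetSum]
    refine Finset.sum_congr rfl fun F _ => ?_
    rw [← Finset.sum_filter, Finset.sum_const, h F]
    simp [mul_comm]
  rw [h1, Finset.sum_comm]
  simp only [sum_mu_flats_through]
  simp

end Arrangement

/-! ### Signed parametrisations of flats -/

section SignedParam

variable {n : ℕ} {K : Set ℝ} {I : Finset (Fin n)}

/-- A function on `ℝⁿ` that is `x_i` or `-x_i` for some `i ∈ I`, or a constant from `K`. -/
def IsSignedTerm (K : Set ℝ) (I : Finset (Fin n)) (t : (Fin n → ℝ) → ℝ) : Prop :=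
  (∃ i ∈ I, t = fun x => x i) ∨ (∃ i ∈ I, t = fun x => -x i) ∨ ∃ c ∈ K, t = fun _ => c

/-- `F` is the set of solutions of a system `x_j = t_j(x)`, one equation for each coordinate `j`,
where every `t_j` is a signed term in the coordinates from `I`, and `t_i(x) = x_i` for `i ∈ I`. The
coordinates in `I` are then free and determine the others. -/
def SignedParam (K : Set ℝ) (I : Finset (Fin n)) (F : AffineSubspace ℝ (Fin n → ℝ)) : Prop :=
  ∃ t : Fin n → (Fin n → ℝ) → ℝ, (∀ j, IsSignedTerm K I (t j)) ∧
    (∀ i ∈ I, t i = fun x => x i) ∧ ∀ x, x ∈ F ↔ ∀ j, x j = t j x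

theorem IsSignedTerm.congr {t : (Fin n → ℝ) → ℝ} (ht : IsSignedTerm K I t) {x y : Fin n → ℝ}
    (h : ∀ i ∈ I, x i = y i) : t x = t y := by
  obtain ⟨i, hi, rfl⟩ | ⟨i, hi, rfl⟩ | ⟨c, -, rfl⟩ := ht
  · exact h i hi
  · exact congrArg _ (h i hi)
  · rfl

theorem IsSignedTerm.neg (hK : ∀ c ∈ K, -c ∈ K) {t : (Fin n → ℝ) → ℝ} (ht : IsSignedTerm K I t) :
    IsSignedTerm K I fun x => -t x := by
  obtain ⟨i, hi, rfl⟩ | ⟨i, hi, rfl⟩ | ⟨c, hc, rfl⟩ := ht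
  · exact Or.inr (Or.inl ⟨i, hi, rfl⟩)
  · exact Or.inl ⟨i, hi, by simp⟩
  · exact Or.inr (Or.inr ⟨-c, hK c hc, rfl⟩)

theorem IsSignedTerm.mem {X : Finset ℝ} (hX : ∀ a ∈ X, -a ∈ X) (hKX : ∀ c ∈ K, c ∈ X)
    {t : (Fin n → ℝ) → ℝ} (ht : IsSignedTerm K I t) {x : Fin n → ℝ} (hx : ∀ i ∈ I, x i ∈ X) :
    t x ∈ X := by
  obtain ⟨i, hi, rfl⟩ | ⟨i, hi, rfl⟩ | ⟨c, hc, rfl⟩ := ht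
  · exact hx i hi
  · exact hX _ (hx i hi)
  · exact hKX c hc

namespace SignedParam

variable {F : AffineSubspace ℝ (Fin n → ℝ)}

theorem top : SignedParam K Finset.univ (⊤ : AffineSubspace ℝ (Fin n → ℝ)) :=
  ⟨fun j x => x j, fun j => Or.inl ⟨j, Finset.mem_univ j, rfl⟩, fun _ _ => rfl, by simp⟩

theorem eq_of_agree (hF : SignedParam K I F) {x y : Fin n → ℝ} (hx : x ∈ F) (hy : y ∈ F)
    (h : ∀ i ∈ I, x i = y i) : x = y := by
  obtain ⟨t, ht, -, hm⟩ := hF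
  funext j
  rw [(hm x).1 hx j, (hm y).1 hy j]
  exact (ht j).congr h

/-- The free coordinates of a point of `F` can be prescribed. If they lie in a symmetric set `X`
containing the constants, so do all the coordinates. -/
theorem exists_mem (hF : SignedParam K I F) (y : Fin n → ℝ) :
    ∃ x ∈ F, (∀ i ∈ I, x i = y i) ∧
      ∀ X : Finset ℝ, (∀ a ∈ X, -a ∈ X) → (∀ c ∈ K, c ∈ X) → (∀ i ∈ I, y i ∈ X) → ∀ j, x j ∈ X := by
  obtain ⟨t, ht, hI, hm⟩ := hF
  have hxy : ∀ i ∈ I, t i y = y i := fun i hi => by rw [hI i hi]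
  exact ⟨fun j => t j y, (hm _).2 fun j => (ht j).congr fun i hi => (hxy i hi).symm, hxy,
    fun X hX hKX hy j => (ht j).mem hX hKX hy⟩

/-- A parametrised `F` contains exactly `|X| ^ |I|` points of the grid `Xⁿ`. -/
theorem card_grid [DecidablePred (· ∈ F)] (hF : SignedParam K I F) {X : Finset ℝ}
    (hX : ∀ a ∈ X, -a ∈ X) (hKX : ∀ c ∈ K, c ∈ X) :
    ((Fintype.piFinset fun _ : Fin n => X).filter (· ∈ F)).card = X.card ^ I.card := by
  have h : ((Fintype.piFinset fun _ : Fin n => X).filter (· ∈ F)).card =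
      (Fintype.piFinset fun _ : I => X).card := by
    refine Finset.card_bij (fun x _ i => x i) ?_ ?_ ?_
    · intro x hx
      simp only [Finset.mem_filter, Fintype.mem_piFinset] at hx ⊢
      exact fun i => hx.1 i
    · intro x hx y hy hxy
      simp only [Finset.mem_filter] at hx hy
      exact hF.eq_of_agree hx.2 hy.2 fun i hi => congrFun hxy ⟨i, hi⟩
    · intro y hy
      simp only [Fintype.mem_piFinset] at hy
      obtain ⟨x, hxF, hxI, hxX⟩ := hF.exists_mem fun i => if hi : i ∈ I then y ⟨i, hi⟩ else 0
      refine ⟨x, ?_, ?_⟩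
      · simp only [Finset.mem_filter, Fintype.mem_piFinset]
        refine ⟨hxX X hX hKX fun i hi => ?_, hxF⟩
        simpa [hi] using hy ⟨i, hi⟩
      · funext i
        simpa using hxI i i.2
  rw [h, Fintype.card_piFinset]
  simp

theorem finrank_direction (hF : SignedParam K I F) :
    Module.finrank ℝ F.direction = I.card := by
  obtain ⟨p, hp, -⟩ := hF.exists_mem 0
  let L : F.direction →ₗ[ℝ] (I → ℝ) :=
    (LinearMap.funLeft ℝ ℝ (Subtype.val : I → Fin n)).comp F.direction.subtype
  have hL : Function.Bijective L := by
    constructor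
    · rw [injective_iff_map_eq_zero]
      intro v hv
      have hvp : (v : Fin n → ℝ) + p ∈ F :=
        (AffineSubspace.vadd_mem_iff_mem_direction (v : Fin n → ℝ) hp).2 v.2
      have := hF.eq_of_agree hvp hp fun i hi => by
        have h : (v : Fin n → ℝ) i = 0 := congrFun hv ⟨i, hi⟩
        simp [h]
      exact Subtype.ext (by simpa using this)
    · intro y
      obtain ⟨q, hq, hqy, -⟩ := hF.exists_mem fun i => if hi : i ∈ I then y ⟨i, hi⟩ + p i else 0
      refine ⟨⟨q - p, AffineSubspace.vsub_mem_direction hq hp⟩, funext fun i => ?_⟩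
      have h : q i = y i + p i := by simpa using hqy i i.2
      change q i - p i = y i
      rw [h, add_sub_cancel_right]
  rw [(LinearEquiv.ofBijective L hL).finrank_eq]
  simp

/-- Eliminating the free coordinate `i` by means of an equation `x_i = u(x)`. -/
theorem substitute (hK : ∀ c ∈ K, -c ∈ K) (hF : SignedParam K I F) {i : Fin n} (hi : i ∈ I)
    {u : (Fin n → ℝ) → ℝ} (hu : IsSignedTerm K (I.erase i) u) {G : AffineSubspace ℝ (Fin n → ℝ)}
    (hG : ∀ x, x ∈ G ↔ x ∈ F ∧ x i = u x) : SignedParam K (I.erase i) G := by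
  obtain ⟨t, ht, hI, hm⟩ := hF
  refine ⟨fun j x => t j (Function.update x i (u x)), fun j => ?_, fun j hj => ?_, fun x => ?_⟩
  · obtain ⟨k, hk, h⟩ | ⟨k, hk, h⟩ | ⟨c, hc, h⟩ := ht j
    · by_cases hki : k = i
      · subst hki
        simpa [h] using hu
      · exact Or.inl ⟨k, Finset.mem_erase.2 ⟨hki, hk⟩, by simp [h, hki]⟩
    · by_cases hki : k = i
      · subst hki
        simpa [h] using hu.neg hK
      · exact Or.inr (Or.inl ⟨k, Finset.mem_erase.2 ⟨hki, hk⟩, by simp [h, hki]⟩)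
    · exact Or.inr (Or.inr ⟨c, hc, by simp [h]⟩)
  · rw [Finset.mem_erase] at hj
    simp [hI j hj.2, hj.1]
  · rw [hG, hm]
    constructor
    · rintro ⟨h, hxi⟩ j
      change x j = t j (Function.update x i (u x))
      rw [← hxi, Function.update_eq_self]
      exact h j
    · intro h
      have hxi : x i = u x := by simpa [hI i hi] using h i
      refine ⟨fun j => ?_, hxi⟩
      have : x j = t j (Function.update x i (u x)) := h j
      rwa [← hxi, Function.update_eq_self] at this

theorem inter_coord_eq (hK0 : (0 : ℝ) ∈ K) (hK : ∀ c ∈ K, -c ∈ K) (hF : SignedParam K I F)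
    {i : Fin n} (hi : i ∈ I) {u : (Fin n → ℝ) → ℝ} (hu : IsSignedTerm K I u)
    {G : AffineSubspace ℝ (Fin n → ℝ)} (hG : ∀ x, x ∈ G ↔ x ∈ F ∧ x i = u x) :
    ∃ J, SignedParam K J G := by
  obtain ⟨k, hk, rfl⟩ | ⟨k, hk, rfl⟩ | ⟨c, hc, rfl⟩ := hu
  · by_cases hki : k = i
    · subst hki
      have : G = F := by ext x; simp [hG]
      exact ⟨I, this ▸ hF⟩
    · exact ⟨_, hF.substitute hK hi (Or.inl ⟨k, Finset.mem_erase.2 ⟨hki, hk⟩, rfl⟩) hG⟩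
  · by_cases hki : k = i
    · subst hki
      -- The equation `x_k = -x_k` says `x_k = 0`.
      refine ⟨_, hF.substitute hK hi (Or.inr (Or.inr ⟨0, hK0, rfl⟩)) fun x => ?_⟩
      rw [hG, self_eq_neg]
    · exact ⟨_, hF.substitute hK hi
        (Or.inr (Or.inl ⟨k, Finset.mem_erase.2 ⟨hki, hk⟩, rfl⟩)) hG⟩
  · exact ⟨_, hF.substitute hK hi (Or.inr (Or.inr ⟨c, hc, rfl⟩)) hG⟩

theorem inter_term_eq (hK0 : (0 : ℝ) ∈ K) (hK : ∀ c ∈ K, -c ∈ K) (hF : SignedParam K I F)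
    {u v : (Fin n → ℝ) → ℝ} (hu : IsSignedTerm K I u) (hv : IsSignedTerm K I v)
    {G : AffineSubspace ℝ (Fin n → ℝ)} (hG : ∀ x, x ∈ G ↔ x ∈ F ∧ u x = v x)
    (hne : ∃ x, x ∈ G) : ∃ J, SignedParam K J G := by
  obtain ⟨i, hi, rfl⟩ | ⟨i, hi, rfl⟩ | ⟨c, hc, rfl⟩ := hu
  · exact hF.inter_coord_eq hK0 hK hi hv hG
  · refine hF.inter_coord_eq hK0 hK hi (hv.neg hK) fun x => ?_
    rw [hG, neg_eq_iff_eq_neg]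
  · obtain ⟨i, hi, rfl⟩ | ⟨i, hi, rfl⟩ | ⟨d, hd, rfl⟩ := hv
    · refine hF.inter_coord_eq hK0 hK hi (Or.inr (Or.inr ⟨c, hc, rfl⟩)) fun x => ?_
      rw [hG, eq_comm (a := c)]
    · refine hF.inter_coord_eq hK0 hK hi (Or.inr (Or.inr ⟨-c, hK c hc, rfl⟩)) fun x => ?_
      rw [hG, eq_comm (a := c), neg_eq_iff_eq_neg]
    · obtain ⟨x, hx⟩ := hne
      have hcd : c = d := ((hG x).1 hx).2
      have : G = F := by ext x; simp [hG, hcd]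
      exact ⟨I, this ▸ hF⟩

end SignedParam

/-- The hyperplanes `x_i + x_j = 0`, `x_i - x_j = 0` and `x_i = c` with `c ∈ K`. -/
def IsSignedHyperplane (K : Set ℝ) (H : AffineSubspace ℝ (Fin n → ℝ)) : Prop :=
  (∃ i j, H = sumHyperplane i j) ∨ (∃ i j, H = diffHyperplane i j) ∨
    ∃ i, ∃ c ∈ K, H = coordHyperplane i c

theorem SignedParam.inter_hyperplane {F H : AffineSubspace ℝ (Fin n → ℝ)} (hK0 : (0 : ℝ) ∈ K)
    (hK : ∀ c ∈ K, -c ∈ K) (hF : SignedParam K I F) (hH : IsSignedHyperplane K H)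
    (hne : ∃ x, x ∈ H ⊓ F) : ∃ J, SignedParam K J (H ⊓ F) := by
  obtain ⟨t, ht, -, hm⟩ := id hF
  obtain ⟨i, j, rfl⟩ | ⟨i, j, rfl⟩ | ⟨i, c, hc, rfl⟩ := hH
  · refine hF.inter_term_eq hK0 hK (ht i) ((ht j).neg hK) (fun x => ?_) hne
    rw [AffineSubspace.mem_inf_iff, and_comm, and_congr_right]
    intro hx
    rw [← (hm x).1 hx i, ← (hm x).1 hx j]
    change x i + x j = 0 ↔ _
    rw [add_eq_zero_iff_eq_neg]
  · refine hF.inter_term_eq hK0 hK (ht i) (ht j) (fun x => ?_) hne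
    rw [AffineSubspace.mem_inf_iff, and_comm, and_congr_right]
    intro hx
    rw [← (hm x).1 hx i, ← (hm x).1 hx j]
    change x i - x j = 0 ↔ _
    rw [sub_eq_zero]
  · refine hF.inter_term_eq hK0 hK (ht i) (Or.inr (Or.inr ⟨c, hc, rfl⟩)) (fun x => ?_) hne
    rw [AffineSubspace.mem_inf_iff, and_comm, and_congr_right]
    intro hx
    rw [← (hm x).1 hx i]
    rfl

theorem signedParam_sInf (hK0 : (0 : ℝ) ∈ K) (hK : ∀ c ∈ K, -c ∈ K)
    {S : Set (AffineSubspace ℝ (Fin n → ℝ))} (hS : S.Finite) :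
    (∀ H ∈ S, IsSignedHyperplane K H) → (∃ x, x ∈ sInf S) → ∃ I, SignedParam K I (sInf S) := by
  induction S, hS using Set.Finite.induction_on with
  | empty => exact fun _ _ => ⟨_, by rw [sInf_empty]; exact SignedParam.top⟩
  | @insert H S _ _ ih =>
    intro h hne
    rw [sInf_insert] at hne ⊢
    obtain ⟨x, hx⟩ := id hne
    obtain ⟨I, hF⟩ := ih (fun H' hH' => h H' (Set.mem_insert_of_mem _ hH'))
      ⟨x, ((AffineSubspace.mem_inf_iff _ _ _).1 hx).2⟩
    exact hF.inter_hyperplane hK0 hK (h H (Set.mem_insert _ _)) hne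

open Classical in
/-- The characteristic polynomial at `|X|` counts the points of `Xⁿ` off the arrangement. -/
theorem eval_charPoly_eq_card_grid (hK0 : (0 : ℝ) ∈ K) (hK : ∀ c ∈ K, -c ∈ K) (A : Arrangement n)
    (hA : ∀ H ∈ A.hyperplanes, IsSignedHyperplane K H) {X : Finset ℝ}
    (hX : ∀ a ∈ X, -a ∈ X) (hKX : ∀ c ∈ K, c ∈ X) :
    A.charPoly.eval (X.card : ℤ) =
      ((Fintype.piFinset fun _ : Fin n => X).filter (· ∈ A.complement)).card := by
  refine A.eval_charPoly _ _ fun F => ?_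
  obtain ⟨hne, S, hS, hF⟩ := F.isFlat
  obtain ⟨I, hI⟩ : ∃ I, SignedParam K I F.flat := by
    rw [hF] at hne ⊢
    exact signedParam_sInf hK0 hK (A.finite.subset hS) (fun H hH => hA H (hS hH)) hne
  rw [hI.card_grid hX hKX, Arrangement.IntersectionPoset.dim, hI.finrank_direction]

end SignedParam

/-! ### The characteristic polynomial of a boxed arrangement -/

/-- The symmetric grid `{k / 2 | -m ≤ k ≤ m}`. -/
noncomputable def halfGrid (m : ℕ) : Finset ℝ :=
  (Finset.Icc (-(m : ℤ)) m).map
    ⟨fun k : ℤ => (k : ℝ) / 2, fun a b h => by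
      have : (a : ℝ) = b := by simpa using h
      exact_mod_cast this⟩

theorem card_halfGrid (m : ℕ) : (halfGrid m).card = 2 * m + 1 := by
  rw [halfGrid, Finset.card_map, Int.card_Icc]
  omega

theorem mem_halfGrid {m : ℕ} {a : ℝ} :
    a ∈ halfGrid m ↔ ∃ k : ℤ, (-(m : ℤ) ≤ k ∧ k ≤ m) ∧ (k : ℝ) / 2 = a := by
  simp only [halfGrid, Finset.mem_map, Finset.mem_Icc]
  rfl

theorem neg_mem_halfGrid {m : ℕ} {a : ℝ} (h : a ∈ halfGrid m) : -a ∈ halfGrid m := by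
  rw [mem_halfGrid] at h ⊢
  obtain ⟨k, hk, rfl⟩ := h
  exact ⟨-k, by omega, by push_cast; ring⟩

theorem zero_mem_halfGrid (m : ℕ) : (0 : ℝ) ∈ halfGrid m :=
  mem_halfGrid.2 ⟨0, by omega, by simp⟩

theorem half_mem_halfGrid (m : ℕ) : (1 / 2 : ℝ) ∈ halfGrid (m + 1) :=
  mem_halfGrid.2 ⟨1, by push_cast; omega, by simp⟩

theorem charPoly_boxed {n : ℕ} (A : Arrangement n) (hA : A.hyperplanes ⊆ (typeC n).hyperplanes) :
    A.boxed.charPoly = A.charPoly.comp (Polynomial.X - 2) := by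
  classical
  have hA0 : ∀ H ∈ A.hyperplanes, IsSignedHyperplane {0} H := by
    intro H hH
    obtain (⟨i, j, -, h⟩ | ⟨i, j, -, h⟩) | ⟨i, h⟩ := hA hH
    · exact Or.inl ⟨i, j, h⟩
    · exact Or.inr (Or.inl ⟨i, j, h⟩)
    · exact Or.inr (Or.inr ⟨i, 0, rfl, h⟩)
  have hB : ∀ H ∈ A.boxed.hyperplanes, IsSignedHyperplane {0, 1 / 2, -(1 / 2)} H := by
    rintro H (hH | ⟨i, h⟩ | ⟨i, h⟩)
    · obtain h | h | ⟨i, c, hc, h⟩ := hA0 H hH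
      · exact Or.inl h
      · exact Or.inr (Or.inl h)
      · exact Or.inr (Or.inr ⟨i, c, Or.inl hc, h⟩)
    · exact Or.inr (Or.inr ⟨i, _, by simp, h⟩)
    · exact Or.inr (Or.inr ⟨i, _, by simp, h⟩)
  apply Polynomial.eq_of_infinite_eval_eq
  refine (Set.infinite_range_of_injective (f := fun m : ℕ => ((2 * (m + 1) + 1 : ℕ) : ℤ))
    fun a b h => by simpa using h).mono ?_
  rintro _ ⟨m, rfl⟩
  let X := halfGrid (m + 1)
  let Y := (X.erase (1 / 2)).erase (-(1 / 2))
  have hX : ∀ a ∈ X, -a ∈ X := fun a => neg_mem_halfGrid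
  have hhalf : (1 / 2 : ℝ) ∈ X := half_mem_halfGrid m
  have hYmem : ∀ a, a ∈ Y ↔ a ≠ -(1 / 2) ∧ a ≠ 1 / 2 ∧ a ∈ X := fun a => by
    simp only [Y, Finset.mem_erase]
  have hXcard : X.card = 2 * (m + 1) + 1 := card_halfGrid (m + 1)
  have hYcard : Y.card = 2 * m + 1 := by
    have h1 : (-(1 / 2) : ℝ) ∈ X.erase (1 / 2) :=
      Finset.mem_erase.2 ⟨by norm_num, hX _ hhalf⟩
    rw [Finset.card_erase_of_mem h1, Finset.card_erase_of_mem hhalf, hXcard]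
    omega
  have e1 := eval_charPoly_eq_card_grid (K := {0, 1 / 2, -(1 / 2)}) (by simp)
    (by rintro c (rfl | rfl | rfl) <;> simp) A.boxed hB hX
    (by
      rintro c (rfl | rfl | rfl)
      exacts [zero_mem_halfGrid _, hhalf, hX _ hhalf])
  have e2 := eval_charPoly_eq_card_grid (K := {0}) rfl (by rintro c rfl; simp) A hA0 (X := Y)
    (by
      intro a ha
      rw [hYmem] at ha ⊢
      exact ⟨fun h => ha.2.1 (neg_injective h), fun h => ha.1 (by rw [← h, neg_neg]), hX a ha.2.2⟩)
    (by
      rintro c rfl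
      exact (hYmem 0).2 ⟨by norm_num, by norm_num, zero_mem_halfGrid _⟩)
  have e3 : (Fintype.piFinset fun _ : Fin n => X).filter (· ∈ A.boxed.complement) =
      (Fintype.piFinset fun _ : Fin n => Y).filter (· ∈ A.complement) := by
    ext x
    simp only [Finset.mem_filter, Fintype.mem_piFinset, hYmem]
    constructor
    · rintro ⟨hx, hc⟩
      exact ⟨fun i => ⟨fun h => hc _ (Or.inr (Or.inl ⟨i, rfl⟩)) h,
        fun h => hc _ (Or.inr (Or.inr ⟨i, rfl⟩)) h, hx i⟩, fun H hH => hc H (Or.inl hH)⟩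
    · rintro ⟨hx, hc⟩
      refine ⟨fun i => (hx i).2.2, ?_⟩
      rintro H (hH | ⟨i, rfl⟩ | ⟨i, rfl⟩)
      exacts [hc H hH, (hx i).1, (hx i).2.1]
  rw [e3, ← e2, hXcard, hYcard] at e1
  rw [Set.mem_ofPred_eq, e1, Polynomial.eval_comp]
  congr 1
  simp
  ring

/-! ### Regions as sign cells -/

/-- The connected component of `x` in the complement of level sets of linear forms consists of the
points lying on the same side of each of them as `x`. -/
theorem mem_connectedComponentIn_iff {n : ℕ} {ι : Type*} (f : ι → (Fin n → ℝ) →ₗ[ℝ] ℝ) (c : ι → ℝ)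
    {x : Fin n → ℝ} (hx : ∀ k, f k x ≠ c k) (y : Fin n → ℝ) :
    y ∈ connectedComponentIn {z | ∀ k, f k z ≠ c k} x ↔
      ∀ k, f k y ≠ c k ∧ (c k < f k y ↔ c k < f k x) := by
  have hx' : x ∈ {z | ∀ k, f k z ≠ c k} := hx
  constructor
  · intro hy k
    have hsub := connectedComponentIn_subset {z | ∀ k, f k z ≠ c k} x
    refine ⟨hsub hy k, ?_⟩
    have hcont : Continuous (f k) := (f k).continuous_of_finiteDimensional
    have hoc := ((isPreconnected_connectedComponentIn (x := x)
      (F := {z | ∀ k, f k z ≠ c k})).image (f k) hcont.continuousOn).ordConnected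
    have hxm := Set.mem_image_of_mem (f k) (mem_connectedComponentIn hx')
    have hym := Set.mem_image_of_mem (f k) hy
    have hc : c k ∉ f k '' connectedComponentIn {z | ∀ k, f k z ≠ c k} x := by
      rintro ⟨z, hz, h⟩
      exact hsub hz k h
    constructor
    · intro h
      by_contra h'
      exact hc (hoc.out hxm hym ⟨not_lt.1 h', h.le⟩)
    · intro h
      by_contra h'
      exact hc (hoc.out hym hxm ⟨not_lt.1 h', h.le⟩)
  · intro hy
    have hconv : Convex ℝ {z | ∀ k, f k z ≠ c k ∧ (c k < f k z ↔ c k < f k x)} := by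
      rw [Set.ofPred_forall]
      refine convex_iInter fun k => ?_
      by_cases h : c k < f k x
      · have hset : {z | f k z ≠ c k ∧ (c k < f k z ↔ c k < f k x)} = {z | c k < f k z} :=
          Set.ext fun z => ⟨fun hz => hz.2.2 h, fun hz => ⟨ne_of_gt hz, iff_of_true hz h⟩⟩
        rw [hset]
        exact convex_halfSpace_gt (f k).isLinear (c k)
      · have hset : {z | f k z ≠ c k ∧ (c k < f k z ↔ c k < f k x)} = {z | f k z < c k} :=
          Set.ext fun z => ⟨fun hz => lt_of_le_of_ne (not_lt.1 fun h' => h (hz.2.1 h')) hz.1,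
            fun hz => ⟨ne_of_lt hz, iff_of_false (not_lt_of_gt hz) h⟩⟩
        rw [hset]
        exact convex_halfSpace_lt (f k).isLinear (c k)
    exact hconv.isPreconnected.subset_connectedComponentIn (fun k => ⟨hx k, Iff.rfl⟩)
      (fun z hz k => (hz k).1) hy

section Threshold

variable {n : ℕ} {x y : Fin n → ℝ}

theorem mem_complement_threshold :
    x ∈ (threshold n).complement ↔ ∀ i j, i < j → x i + x j ≠ 0 := by
  constructor
  · exact fun h i j hij => h _ ⟨i, j, hij, rfl⟩
  · rintro h _ ⟨i, j, hij, rfl⟩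
    exact h i j hij

theorem mem_complement_boxedThreshold :
    x ∈ (boxedThreshold n).complement ↔
      (∀ i j, i < j → x i + x j ≠ 0) ∧ ∀ i, x i ≠ -(1 / 2) ∧ x i ≠ 1 / 2 := by
  constructor
  · exact fun h => ⟨fun i j hij => h _ (Or.inl ⟨i, j, hij, rfl⟩),
      fun i => ⟨h _ (Or.inr (Or.inl ⟨i, rfl⟩)), h _ (Or.inr (Or.inr ⟨i, rfl⟩))⟩⟩
  · rintro h _ (⟨i, j, hij, rfl⟩ | ⟨i, rfl⟩ | ⟨i, rfl⟩)
    exacts [h.1 i j hij, (h.2 i).1, (h.2 i).2]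

theorem mem_region_threshold (hx : x ∈ (threshold n).complement) :
    y ∈ connectedComponentIn (threshold n).complement x ↔
      ∀ i j, i < j → y i + y j ≠ 0 ∧ (0 < y i + y j ↔ 0 < x i + x j) := by
  let f : {p : Fin n × Fin n // p.1 < p.2} → (Fin n → ℝ) →ₗ[ℝ] ℝ :=
    fun p => coord p.1.1 + coord p.1.2
  have h : (threshold n).complement = {z | ∀ k, f k z ≠ 0} := by
    ext z
    rw [mem_complement_threshold]
    exact ⟨fun h p => h _ _ p.2, fun h i j hij => h ⟨(i, j), hij⟩⟩
  rw [h] at hx ⊢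
  rw [mem_connectedComponentIn_iff f (fun _ => 0) hx]
  exact ⟨fun h i j hij => h ⟨(i, j), hij⟩, fun h p => h _ _ p.2⟩

theorem mem_region_boxedThreshold (hx : x ∈ (boxedThreshold n).complement) :
    y ∈ connectedComponentIn (boxedThreshold n).complement x ↔
      (∀ i j, i < j → y i + y j ≠ 0 ∧ (0 < y i + y j ↔ 0 < x i + x j)) ∧
      ∀ i, (y i ≠ -(1 / 2) ∧ (-(1 / 2) < y i ↔ -(1 / 2) < x i)) ∧
        (y i ≠ 1 / 2 ∧ (1 / 2 < y i ↔ 1 / 2 < x i)) := by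
  let f : {p : Fin n × Fin n // p.1 < p.2} ⊕ (Fin n ⊕ Fin n) → (Fin n → ℝ) →ₗ[ℝ] ℝ :=
    Sum.elim (fun p => coord p.1.1 + coord p.1.2) (Sum.elim (fun i => coord i) fun i => coord i)
  let c : {p : Fin n × Fin n // p.1 < p.2} ⊕ (Fin n ⊕ Fin n) → ℝ :=
    Sum.elim (fun _ => 0) (Sum.elim (fun _ => -(1 / 2)) fun _ => 1 / 2)
  have h : (boxedThreshold n).complement = {z | ∀ k, f k z ≠ c k} := by
    ext z
    rw [mem_complement_boxedThreshold]
    constructor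
    · rintro h (p | i | i)
      exacts [h.1 _ _ p.2, (h.2 i).1, (h.2 i).2]
    · exact fun h => ⟨fun i j hij => h (Sum.inl ⟨(i, j), hij⟩),
        fun i => ⟨h (Sum.inr (Sum.inl i)), h (Sum.inr (Sum.inr i))⟩⟩
  rw [h] at hx ⊢
  rw [mem_connectedComponentIn_iff f c hx]
  constructor
  · exact fun h => ⟨fun i j hij => h (Sum.inl ⟨(i, j), hij⟩),
      fun i => ⟨h (Sum.inr (Sum.inl i)), h (Sum.inr (Sum.inr i))⟩⟩
  · rintro h (p | i | i)
    exacts [h.1 _ _ p.2, (h.2 i).1, (h.2 i).2]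

theorem finite_regions_threshold (n : ℕ) : (threshold n).regions.Finite := by
  refine (Set.finite_range fun σ : Fin n → Fin n → Prop =>
    {y : Fin n → ℝ | ∀ i j, i < j → y i + y j ≠ 0 ∧ (0 < y i + y j ↔ σ i j)}).subset ?_
  rintro R ⟨x, hx, rfl⟩
  exact ⟨fun i j => 0 < x i + x j, Set.ext fun y => (mem_region_threshold hx).symm⟩

/-! ### Bounded regions of the boxed threshold arrangement -/

/-- The open box `(-1/2, 1/2)ⁿ`. -/
def openBox (n : ℕ) : Set (Fin n → ℝ) :=
  {x | ∀ i, -(1 / 2) < x i ∧ x i < 1 / 2}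

theorem isBounded_openBox (n : ℕ) : Bornology.IsBounded (openBox n) := by
  refine (Metric.isBounded_closedBall (x := (0 : Fin n → ℝ)) (r := 1)).subset fun x hx => ?_
  rw [mem_closedBall_zero_iff, pi_norm_le_iff_of_nonneg zero_le_one]
  intro i
  rw [Real.norm_eq_abs, abs_le]
  constructor <;> linarith [(hx i).1, (hx i).2]

theorem region_inter_openBox (hx : x ∈ (threshold n).complement) (hbox : x ∈ openBox n) :
    x ∈ (boxedThreshold n).complement ∧
      connectedComponentIn (threshold n).complement x ∩ openBox n =
        connectedComponentIn (boxedThreshold n).complement x := by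
  have hx' : x ∈ (boxedThreshold n).complement :=
    mem_complement_boxedThreshold.2 ⟨mem_complement_threshold.1 hx,
      fun i => ⟨(hbox i).1.ne', (hbox i).2.ne⟩⟩
  refine ⟨hx', Set.ext fun y => ?_⟩
  rw [Set.mem_inter_iff, mem_region_threshold hx, mem_region_boxedThreshold hx', and_congr_right]
  refine fun _ => forall_congr' fun i => ?_
  have h1 := (hbox i).1
  have h2 := not_lt.2 (hbox i).2.le
  simp only [h1, h2, iff_true, iff_false, not_lt]
  exact ⟨fun h => ⟨⟨h.1.ne', h.1⟩, h.2.ne, h.2.le⟩,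
    fun h => ⟨h.1.2, lt_of_le_of_ne h.2.2 h.2.1⟩⟩

/-- The regions of the threshold arrangement are cones, so each of them meets the box. -/
theorem exists_mem_openBox_region (hx : x ∈ (threshold n).complement) :
    ∃ y ∈ openBox n, y ∈ connectedComponentIn (threshold n).complement x := by
  have hpos : 0 < 2 * ‖x‖ + 1 := by positivity
  refine ⟨fun i => x i / (2 * ‖x‖ + 1), fun i => ?_, (mem_region_threshold hx).2 fun i j hij => ?_⟩
  · have h := abs_le.1 ((Real.norm_eq_abs (x i)) ▸ norm_le_pi_norm x i)
    rw [lt_div_iff₀ hpos, div_lt_iff₀ hpos]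
    constructor <;> linarith [h.1, h.2]
  · rw [← add_div, div_pos_iff_of_pos_right hpos]
    exact ⟨div_ne_zero (mem_complement_threshold.1 hx i j hij) hpos.ne', Iff.rfl⟩

/-- If `x` has a coordinate of absolute value greater than `1/2`, then its cell contains the points
obtained by multiplying all such coordinates of `x` by a factor `r ≥ 1`, so it is unbounded. -/
theorem mem_openBox_of_isBounded (hx : x ∈ (boxedThreshold n).complement)
    (hb : Bornology.IsBounded (connectedComponentIn (boxedThreshold n).complement x)) :
    x ∈ openBox n := by
  by_contra hbox
  have hne := mem_complement_boxedThreshold.1 hx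
  obtain ⟨i, hi⟩ : ∃ i, 1 / 2 < |x i| := by
    by_contra! h
    refine hbox fun i => ?_
    have := abs_le.1 (h i)
    exact ⟨lt_of_le_of_ne this.1 (hne.2 i).1.symm, lt_of_le_of_ne this.2 (hne.2 i).2⟩
  obtain ⟨M, hM⟩ := hb.exists_norm_le
  let r : ℝ := 2 * |M| + 1
  have hr : 1 ≤ r := by
    have := abs_nonneg M
    simp only [r]
    linarith
  let y : Fin n → ℝ := fun j => if 1 / 2 < |x j| then r * x j else x j
  have hy : y ∈ connectedComponentIn (boxedThreshold n).complement x := by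
    -- Large coordinates move away from `0`, keeping their sign; the others do not move.
    have key : ∀ j, (1 / 2 < x j ∧ x j ≤ y j) ∨ (x j < -(1 / 2) ∧ y j ≤ x j) ∨
        (-(1 / 2) < x j ∧ x j < 1 / 2 ∧ y j = x j) := by
      intro j
      by_cases h : 1 / 2 < |x j|
      · have hyj : y j = r * x j := if_pos h
        rw [hyj]
        rcases lt_abs.1 h with h | h
        · left; exact ⟨h, by nlinarith⟩
        · right; left; exact ⟨by linarith, by nlinarith⟩
      · have := abs_le.1 (not_lt.1 h)
        exact Or.inr (Or.inr ⟨lt_of_le_of_ne this.1 (hne.2 j).1.symm,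
          lt_of_le_of_ne this.2 (hne.2 j).2, if_neg h⟩)
    rw [mem_region_boxedThreshold hx]
    refine ⟨fun j k hjk => ?_, fun j => ?_⟩
    · have hsum := hne.1 j k hjk
      by_cases hj : 1 / 2 < |x j| <;> by_cases hk : 1 / 2 < |x k|
      · have : y j + y k = r * (x j + x k) := by
          simp only [y, if_pos hj, if_pos hk]; ring
        have hr0 : 0 < r := by linarith
        rw [this, mul_pos_iff_of_pos_left hr0]
        exact ⟨mul_ne_zero hr0.ne' hsum, Iff.rfl⟩
      -- With exactly one large coordinate, the sum has the sign of that coordinate.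
      · have hk' := abs_le.1 (not_lt.1 hk)
        have hyk : y k = x k := if_neg hk
        rw [hyk]
        rcases key j with h | h | h
        · have h1 : 0 < y j + x k := by linarith
          have h2 : 0 < x j + x k := by linarith
          exact ⟨h1.ne', by simp only [h1, h2]⟩
        · have h1 : y j + x k < 0 := by linarith
          have h2 : x j + x k < 0 := by linarith
          exact ⟨h1.ne, by simp only [h1.not_gt, h2.not_gt]⟩
        · rw [h.2.2]
          exact ⟨hsum, Iff.rfl⟩
      · have hj' := abs_le.1 (not_lt.1 hj)
        have hyj : y j = x j := if_neg hj
        rw [hyj]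
        rcases key k with h | h | h
        · have h1 : 0 < x j + y k := by linarith
          have h2 : 0 < x j + x k := by linarith
          exact ⟨h1.ne', by simp only [h1, h2]⟩
        · have h1 : x j + y k < 0 := by linarith
          have h2 : x j + x k < 0 := by linarith
          exact ⟨h1.ne, by simp only [h1.not_gt, h2.not_gt]⟩
        · rw [h.2.2]
          exact ⟨hsum, Iff.rfl⟩
      · have hyj : y j = x j := if_neg hj
        have hyk : y k = x k := if_neg hk
        rw [hyj, hyk]
        exact ⟨hsum, Iff.rfl⟩
    · rcases key j with h | h | h
      · exact ⟨⟨by linarith, by constructor <;> intro <;> linarith⟩,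
          ⟨by linarith, by constructor <;> intro <;> linarith⟩⟩
      · exact ⟨⟨by linarith, by constructor <;> intro <;> linarith⟩,
          ⟨by linarith, by constructor <;> intro <;> linarith⟩⟩
      · rw [h.2.2]
        exact ⟨⟨(hne.2 j).1, Iff.rfl⟩, (hne.2 j).2, Iff.rfl⟩
  have h1 : |y i| ≤ M := (norm_le_pi_norm y i).trans (hM y hy)
  have h2 : y i = r * x i := if_pos hi
  rw [h2, abs_mul, abs_of_pos (by linarith : 0 < r)] at h1
  have h3 : r * (1 / 2) < r * |x i| := mul_lt_mul_of_pos_left hi (by linarith)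
  have h4 := le_abs_self M
  simp only [r] at h1 h3
  linarith

theorem boundedRegions_boxedThreshold (n : ℕ) :
    (boxedThreshold n).boundedRegions = (· ∩ openBox n) '' (threshold n).regions := by
  ext R
  constructor
  · rintro ⟨⟨x, hx, rfl⟩, hb⟩
    have hbox := mem_openBox_of_isBounded hx hb
    have hx' := mem_complement_threshold.2 (mem_complement_boxedThreshold.1 hx).1
    exact ⟨_, ⟨x, hx', rfl⟩, (region_inter_openBox hx' hbox).2⟩
  · rintro ⟨_, ⟨x, hx, rfl⟩, rfl⟩
    obtain ⟨y, hbox, hy⟩ := exists_mem_openBox_region hx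
    obtain ⟨hyB, h⟩ := region_inter_openBox (connectedComponentIn_subset _ _ hy) hbox
    refine ⟨⟨y, hyB, ?_⟩, (isBounded_openBox n).subset Set.inter_subset_right⟩
    rw [← h, ← connectedComponentIn_eq hy]

theorem injOn_inter_openBox (n : ℕ) : Set.InjOn (· ∩ openBox n) (threshold n).regions := by
  rintro _ ⟨x, hx, rfl⟩ _ ⟨x', hx', rfl⟩ h
  obtain ⟨y, hbox, hy⟩ := exists_mem_openBox_region hx
  have hy' : y ∈ connectedComponentIn (threshold n).complement x' ∩ openBox n := by
    change y ∈ (fun R => R ∩ openBox n) (connectedComponentIn (threshold n).complement x')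
    rw [← h]
    exact ⟨hy, hbox⟩
  rw [connectedComponentIn_eq hy, connectedComponentIn_eq hy'.1]

end Threshold

theorem proposition2p2 (n : ℕ) :
    (∀ A : Arrangement n, A.hyperplanes ⊆ (typeC n).hyperplanes →
      A.boxed.charPoly = A.charPoly.comp (Polynomial.X - 2)) ∧
    (boxedThreshold n).charPoly = (threshold n).charPoly.comp (Polynomial.X - 2) ∧
    (threshold n).regions.Finite ∧
    (boxedThreshold n).boundedRegions.Finite ∧
    (boxedThreshold n).boundedRegions.ncard = (threshold n).regions.ncard := by
  refine ⟨charPoly_boxed, charPoly_boxed (threshold n) fun H hH => Or.inl (Or.inl hH),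
    finite_regions_threshold n, ?_, ?_⟩
  · rw [boundedRegions_boxedThreshold]
    exact (finite_regions_threshold n).image _
  · rw [boundedRegions_boxedThreshold, (injOn_inter_openBox n).ncard_image]
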